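/- **Setting.** A *Markov polycategory* $\mathcal P$ consists of a class of objects $X$, each with an underlying standard Borel space $\underline X$, and, for finite ordered tuples $\mathbf A,\mathbf B$ of objects, a set $\mathrm{Hom}(\mathbf A;\mathbf B)$ of Markov kernels from $\underline{\mathbf A}=\prod_r\underline{A_r}$ to $\underline{\mathbf B}=\prod_r\underline{B_r}$ (the empty product is a point). It contains the identity kernels $(X)\to(X)$ and is closed under slotwise composition: for $k:\mathbf A\to(\mathbf B_1,X,\mathbf B_2)$ and $l:(\mathbf C_1,X,\mathbf C_2)\to\mathbf D$, the composite $(\mathbf C_1,\mathbf A,\mathbf C_2)\to(\mathbf B_1,\mathbf D,\mathbf B_2)$ is $$E\mid(\mathbf c_1,\mathbf a,\mathbf c_2)\;\longmapsto\;\int\!\!\int \mathbf 1_E(\mathbf b_1,\mathbf d,\mathbf b_2)\,l(d\mathbf d\mid \mathbf c_1,x,\mathbf c_2)\,k(d(\mathbf b_1,x,\mathbf b_2)\mid\mathbf a).$$ A *color system* consists of a category $\mathcal K$, an ordered (non-symmetric) polycategory $\mathcal M$ with the same objects as $\mathcal K$, and maps $\iota:\mathrm{Hom}_{\mathcal K}(c,d)\to\mathrm{Hom}_{\mathcal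 M}((c);(d))$ preserving identities and composition. A *colored Markov polycategory* over it is a Markov polycategory $\mathcal P$ with object colors $\chi(X)\in\mathrm{Ob}(\mathcal K)$; morphism colors $\psi(k)\in\mathrm{Hom}_{\mathcal M}(\chi(\mathbf A);\chi(\mathbf B))$ for $k\in\mathrm{Hom}(\mathbf A;\mathbf B)$, compatible with identities and slotwise composition; and an interface system, that is, sets $\mathrm{Int}(B,C)\subseteq\mathrm{Hom}_{\mathcal K}(\chi(B),\chi(C))$ of admissible witnesses containing identities and closed under composition, and interface kernels $\kappa_{f;B,C}\in\mathrm{Hom}((B);(C))$ for $f\in\mathrm{Int}(B,C)$ with $\psi(\kappa_{f;B,C})=\iota(f)$, $\kappa_{\mathrm{id};B,B}=\mathrm{id}_B$ and $\kappa_{g\circ f;B,E}=\kappa_{g;C,E}\circ\kappa_{f;B,C}$. A *finite acyclic colored diagram* $D$ in $\mathcal P$ consists of a finite set $V$ of vertices, each labelled by a morphism $k_u:\mathbf A_u\to\mathbf B_u$ of $\mathcal P$, and a finite set of internal wires $e=((u,p),(v,q),f_e)$, each from an output slot $p$ of $u$ to an input slot $q$ of $v$ and carrying a witness $f_e\in\mathrm{Int}(B_{u,p},A_{v,q})$,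 such that each slot lies on at most one wire and the directed graph on $V$ with edges $u\to v$ given by the wires is acyclic; together with chosen orderings of the external input slots (those that are not targets of wires) and of the external output slots (those that are not sources of wires). These give the external profiles $\mathbf I_D$ and $\mathbf O_D$. An *uncolored diagram* is defined in the same way, with the condition $B_{u,p}=A_{v,q}$ in place of a witness on each wire. The *interface expansion* $\widehat D$ is the finite acyclic uncolored diagram obtained by replacing every wire $e=((u,p),(v,q),f_e)$ by a new unary vertex labelled $\kappa_{f_e;B_{u,p},A_{v,q}}$, with a wire from $(u,p)$ to its input slot and a wire from its output slot to $(v,q)$; the external slots and their orderings are kept. Let $u_1,\dots,u_N$ be a topological ordering of the vertices of $\widehat D$. The *trace measure* given $\mathbf x\in\underline{\mathbf I_D}$ is the law of $(\mathbf y_u)_u$ obtained by drawing successively, for $r=1,\dots,N$, $\mathbf y_{u_r}$ from the kernel at $u_r$, where each input slot of $u_r$ is filled with the component of $(\mathbf y_{u_s})_{s<r}$ at the source of the wire ending there or, for an external slot, with the component of $\mathbf x$. The *trace kernel* of $D$ evaluated along this ordering is the image of the trace measure under the projection to the external output slots. **Theorem.** Let $D$ be a finite acyclic colored diagram in a colored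 Markov polycategory. Then the interface expansion $\widehat D$ has a topological ordering, and there is a unique Markov kernel $K_D:\mathbf I_D\to\mathbf O_D$ that equals the trace kernel evaluated along every topological ordering of $\widehat D$. In particular, the trace kernel is a Markov kernel that does not depend on the topological ordering. -/

import Mathlib

open MeasureTheory ProbabilityTheory CategoryTheory

universe u v w x y z

namespace MarkovPoly

/-! ## Values of ordered tuples of objects -/

section Values

variable {Ob : Type u} (S : Ob → Type v)

/-- The set of values of an ordered tuple `L` of objects: the product of the underlying sets of
its entries (a one-point set for the empty tuple), with the product `σ`-algebra of Mathlib. -/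
abbrev Val (L : List Ob) : Type v := ∀ i : Fin L.length, S (L.get i)

variable {S}

/-- Transport of a value along an equality of objects. -/
def castObj {X Y : Ob} (h : X = Y) (a : S X) : S Y := cast (congrArg S h) a

/-- Restriction of a value of a concatenated tuple to the first block. -/
def Val.left {L₁ L₂ : List Ob} (a : Val S (L₁ ++ L₂)) : Val S L₁ := fun i =>
  castObj (S := S) (by simp [List.getElem_append_left i.2])
    (a ⟨i, by have := i.2; simp only [List.length_append]; omega⟩)

/-- Restriction of a value of a concatenated tuple to the second block. -/
def Val.right {L₁ L₂ : List Ob} (a : Val S (L₁ ++ L₂)) : Val S L₂ := fun i =>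
  castObj (S := S) (by simp)
    (a ⟨L₁.length + i, by have := i.2; simp only [List.length_append]; omega⟩)

/-- Concatenation of values. -/
def Val.append {L₁ L₂ : List Ob} (a : Val S L₁) (b : Val S L₂) : Val S (L₁ ++ L₂) := fun i =>
  if h : i.1 < L₁.length then
    castObj (S := S) (by simp [List.getElem_append_left h]) (a ⟨i, h⟩)
  else
    castObj (S := S) (by simp [List.getElem_append_right (not_lt.mp h)])
      (b ⟨i - L₁.length, by have := i.2; simp only [List.length_append] at this; omega⟩)

/-- The first entry of a value of a nonempty tuple. -/
def Val.head {X : Ob} {L : List Ob} (a : Val S (X :: L)) : S X := a 0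

/-- All entries but the first one. -/
def Val.tail {X : Ob} {L : List Ob} (a : Val S (X :: L)) : Val S L := fun i => a i.succ

/-- The value whose first entry is `z` and whose other entries are those of `a`. -/
def Val.cons {X : Ob} {L : List Ob} (z : S X) (a : Val S L) : Val S (X :: L) :=
  Fin.cons (α := fun i : Fin (L.length + 1) => S ((X :: L).get i)) z a

variable [∀ X, MeasurableSpace (S X)]

lemma measurable_castObj {X Y : Ob} (h : X = Y) : Measurable (castObj (S := S) h) := by
  subst h; exact measurable_id

lemma Val.measurable_left {L₁ L₂ : List Ob} :
    Measurable (Val.left : Val S (L₁ ++ L₂) → Val S L₁) :=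
  measurable_pi_lambda _ fun _ => (measurable_castObj _).comp (measurable_pi_apply _)

lemma Val.measurable_right {L₁ L₂ : List Ob} :
    Measurable (Val.right : Val S (L₁ ++ L₂) → Val S L₂) :=
  measurable_pi_lambda _ fun _ => (measurable_castObj _).comp (measurable_pi_apply _)

lemma Val.measurable_append {L₁ L₂ : List Ob} :
    Measurable (fun p : Val S L₁ × Val S L₂ => p.1.append p.2) := by
  refine measurable_pi_lambda _ fun i => ?_
  by_cases h : i.1 < L₁.length
  · simp only [Val.append, h, dite_true]
    exact (measurable_castObj _).comp ((measurable_pi_apply _).comp measurable_fst)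
  · simp only [Val.append, h, dite_false]
    exact (measurable_castObj _).comp ((measurable_pi_apply _).comp measurable_snd)

lemma Val.measurable_head {X : Ob} {L : List Ob} :
    Measurable (Val.head : Val S (X :: L) → S X) :=
  measurable_pi_apply (X := fun i : Fin (X :: L).length => S ((X :: L).get i)) 0

lemma Val.measurable_tail {X : Ob} {L : List Ob} :
    Measurable (Val.tail : Val S (X :: L) → Val S L) :=
  measurable_pi_lambda _ fun i =>
    measurable_pi_apply (X := fun i : Fin (X :: L).length => S ((X :: L).get i)) i.succ

lemma Val.measurable_cons {X : Ob} {L : List Ob} :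
    Measurable (fun p : S X × Val S L => (Val.cons p.1 p.2 : Val S (X :: L))) := by
  refine measurable_pi_lambda _ fun i => ?_
  refine Fin.cases ?_ (fun j => ?_) i
  · exact measurable_fst
  · exact (measurable_pi_apply j).comp measurable_snd

end Values

/-! ## Kernel slotwise composition -/

section KSC

variable {Ob : Type u} {S : Ob → Type v}

/-- The input tuple of `l` in a slotwise composite: the entries of the outer input tuple that
belong to `C₁` and `C₂`, with the connected value `z` in between. -/
def kscFill {A C₁ C₂ : List Ob} {X : Ob} (c : Val S (C₁ ++ A ++ C₂)) (z : S X) :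
    Val S (C₁ ++ X :: C₂) :=
  c.left.left.append (Val.cons z c.right)

/-- The output tuple of a slotwise composite: the connected entry of `b` is removed and the tuple
`d` is inserted in its place. -/
def kscInsert {B₁ B₂ D : List Ob} {X : Ob} (b : Val S (B₁ ++ X :: B₂)) (d : Val S D) :
    Val S (B₁ ++ D ++ B₂) :=
  (b.left.append d).append b.right.tail

variable [∀ X, MeasurableSpace (S X)]

lemma measurable_kscFill {A C₁ C₂ : List Ob} {X : Ob} :
    Measurable (fun p : Val S (C₁ ++ A ++ C₂) × S X => kscFill p.1 p.2) :=
  Val.measurable_append.comp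
    (((Val.measurable_left.comp Val.measurable_left).comp measurable_fst).prodMk
      (Val.measurable_cons.comp
        (measurable_snd.prodMk (Val.measurable_right.comp measurable_fst))))

lemma measurable_kscInsert {B₁ B₂ D : List Ob} {X : Ob} :
    Measurable (fun p : Val S (B₁ ++ X :: B₂) × Val S D => kscInsert p.1 p.2) :=
  Val.measurable_append.comp
    ((Val.measurable_append.comp
      ((Val.measurable_left.comp measurable_fst).prodMk measurable_snd)).prodMk
      ((Val.measurable_tail.comp Val.measurable_right).comp measurable_fst))

/-- Kernel slotwise composition of `k : A → (B₁, X, B₂)` and `l : (C₁, X, C₂) → D` along `X`: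
`b` is drawn from `k`, then `d` is drawn from `l` with the `X`-entry of `b` in the connected input
slot, and the connected value is forgotten. -/
noncomputable def ksc {A B₁ B₂ C₁ C₂ D : List Ob} {X : Ob}
    (k : Kernel (Val S A) (Val S (B₁ ++ X :: B₂)))
    (l : Kernel (Val S (C₁ ++ X :: C₂)) (Val S D)) :
    Kernel (Val S (C₁ ++ A ++ C₂)) (Val S (B₁ ++ D ++ B₂)) :=
  ((k.comap (fun c : Val S (C₁ ++ A ++ C₂) => c.left.right)
      (Val.measurable_right.comp Val.measurable_left)) ⊗ₖ
    (l.comap (fun p : Val S (C₁ ++ A ++ C₂) × Val S (B₁ ++ X :: B₂) =>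
        kscFill p.1 p.2.right.head)
      (measurable_kscFill.comp (measurable_fst.prodMk
        ((Val.measurable_head.comp Val.measurable_right).comp measurable_snd))))).map
    (fun p => kscInsert p.1 p.2)

end KSC

/-! ## Ordered polycategories and color systems -/

/-- An ordered polycategory with class of objects `Ob`. The slotwise composite of
`k : A → (B₁, X, B₂)` and `l : (C₁, X, C₂) → D` goes from `(C₁, A, C₂)` to `(B₁, D, B₂)`; the
profiles are carried with proofs that they have this form, so that no transport is needed in the
axioms. There are no permutations of wires: the two interchange laws are imposed when the external
wires of both sides come in the same order. -/
structure OrderedPolycategory (Ob : Type u) where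
  /-- Morphisms with given input and output profiles. -/
  Hom : List Ob → List Ob → Type v
  /-- Identities. -/
  id : ∀ X : Ob, Hom [X] [X]
  /-- Slotwise composition. -/
  comp : ∀ {A B C D Γ Δ : List Ob} (B₁ B₂ C₁ C₂ : List Ob) (X : Ob), Hom A B → Hom C D →
    B = B₁ ++ X :: B₂ → C = C₁ ++ X :: C₂ → Γ = C₁ ++ A ++ C₂ → Δ = B₁ ++ D ++ B₂ → Hom Γ Δ
  comp_id : ∀ {A B B₁ B₂ : List Ob} {X : Ob} (k : Hom A B) (hB : B = B₁ ++ X :: B₂)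
    (hC : [X] = [] ++ X :: []) (hΓ : A = [] ++ A ++ []) (hΔ : B = B₁ ++ [X] ++ B₂),
    comp B₁ B₂ [] [] X k (id X) hB hC hΓ hΔ = k
  id_comp : ∀ {C D C₁ C₂ : List Ob} {X : Ob} (l : Hom C D) (hB : [X] = [] ++ X :: [])
    (hC : C = C₁ ++ X :: C₂) (hΓ : C = C₁ ++ [X] ++ C₂) (hΔ : D = [] ++ D ++ []),
    comp [] [] C₁ C₂ X (id X) l hB hC hΓ hΔ = l
  /-- Associativity for `f`, `g`, `h` composed in a row. -/
  assoc : ∀ {A B C D E F P Q R T Γ Δ B₁ B₂ C₁ C₂ D₁ D₂ E₁ E₂ : List Ob} {X Y : Ob}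
    (f : Hom A B) (g : Hom C D) (h : Hom E F)
    (hB : B = B₁ ++ X :: B₂) (hC : C = C₁ ++ X :: C₂)
    (hP : P = C₁ ++ A ++ C₂) (hQ : Q = B₁ ++ D ++ B₂)
    (hD : D = D₁ ++ Y :: D₂) (hE : E = E₁ ++ Y :: E₂)
    (hR : R = E₁ ++ C ++ E₂) (hT : T = D₁ ++ F ++ D₂)
    (hQ' : Q = (B₁ ++ D₁) ++ Y :: (D₂ ++ B₂)) (hΓ : Γ = E₁ ++ P ++ E₂)
    (hΔ : Δ = (B₁ ++ D₁) ++ F ++ (D₂ ++ B₂))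
    (hR' : R = (E₁ ++ C₁) ++ X :: (C₂ ++ E₂)) (hΓ' : Γ = (E₁ ++ C₁) ++ A ++ (C₂ ++ E₂))
    (hΔ' : Δ = B₁ ++ T ++ B₂),
    comp (B₁ ++ D₁) (D₂ ++ B₂) E₁ E₂ Y (comp B₁ B₂ C₁ C₂ X f g hB hC hP hQ) h hQ' hE hΓ hΔ =
      comp B₁ B₂ (E₁ ++ C₁) (C₂ ++ E₂) X f (comp D₁ D₂ E₁ E₂ Y g h hD hE hR hT) hB hR' hΓ' hΔ'
  /-- Interchange for two morphisms `f`, `f'` composed into two input slots of `g`. -/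
  interchange_in : ∀ {A A' B B' C D P P' Q Q' Γ Δ B₁ B₂ B₁' B₂' C₁ C₂ C₃ : List Ob} {X Y : Ob}
    (f : Hom A B) (f' : Hom A' B') (g : Hom C D),
    (B₁ = [] ∨ B₁' = []) → (B₂ = [] ∨ B₂' = []) →
    ∀ (hB : B = B₁ ++ X :: B₂) (hB' : B' = B₁' ++ Y :: B₂')
    (hCX : C = C₁ ++ X :: (C₂ ++ Y :: C₃)) (hCY : C = (C₁ ++ X :: C₂) ++ Y :: C₃)
    (hP : P = C₁ ++ A ++ (C₂ ++ Y :: C₃)) (hQ : Q = B₁ ++ D ++ B₂)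
    (hP' : P' = (C₁ ++ X :: C₂) ++ A' ++ C₃) (hQ' : Q' = B₁' ++ D ++ B₂')
    (hPY : P = (C₁ ++ A ++ C₂) ++ Y :: C₃) (hPX : P' = C₁ ++ X :: (C₂ ++ A' ++ C₃))
    (hΓ : Γ = (C₁ ++ A ++ C₂) ++ A' ++ C₃) (hΓ' : Γ = C₁ ++ A ++ (C₂ ++ A' ++ C₃))
    (hΔ : Δ = B₁' ++ Q ++ B₂') (hΔ' : Δ = B₁ ++ Q' ++ B₂),
    comp B₁' B₂' (C₁ ++ A ++ C₂) C₃ Y f'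
        (comp B₁ B₂ C₁ (C₂ ++ Y :: C₃) X f g hB hCX hP hQ) hB' hPY hΓ hΔ =
      comp B₁ B₂ C₁ (C₂ ++ A' ++ C₃) X f
        (comp B₁' B₂' (C₁ ++ X :: C₂) C₃ Y f' g hB' hCY hP' hQ') hB hPX hΓ' hΔ'
  /-- Interchange for two morphisms `g`, `g'` composed onto two output slots of `f`. -/
  interchange_out : ∀ {A B C C' D D' P P' Q Q' Γ Δ B₁ B₂ B₃ C₁ C₂ C₁' C₂' : List Ob} {X Y : Ob}
    (f : Hom A B) (g : Hom C D) (g' : Hom C' D'),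
    (C₁ = [] ∨ C₁' = []) → (C₂ = [] ∨ C₂' = []) →
    ∀ (hC : C = C₁ ++ X :: C₂) (hC' : C' = C₁' ++ Y :: C₂')
    (hBX : B = B₁ ++ X :: (B₂ ++ Y :: B₃)) (hBY : B = (B₁ ++ X :: B₂) ++ Y :: B₃)
    (hP : P = C₁ ++ A ++ C₂) (hQ : Q = B₁ ++ D ++ (B₂ ++ Y :: B₃))
    (hP' : P' = C₁' ++ A ++ C₂') (hQ' : Q' = (B₁ ++ X :: B₂) ++ D' ++ B₃)
    (hQY : Q = (B₁ ++ D ++ B₂) ++ Y :: B₃) (hQX : Q' = B₁ ++ X :: (B₂ ++ D' ++ B₃))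
    (hΓ : Γ = C₁' ++ P ++ C₂') (hΓ' : Γ = C₁ ++ P' ++ C₂)
    (hΔ : Δ = (B₁ ++ D ++ B₂) ++ D' ++ B₃) (hΔ' : Δ = B₁ ++ D ++ (B₂ ++ D' ++ B₃)),
    comp (B₁ ++ D ++ B₂) B₃ C₁' C₂' Y
        (comp B₁ (B₂ ++ Y :: B₃) C₁ C₂ X f g hBX hC hP hQ) g' hQY hC' hΓ hΔ =
      comp B₁ (B₂ ++ D' ++ B₃) C₁ C₂ X
        (comp (B₁ ++ X :: B₂) B₃ C₁' C₂' Y f g' hBY hC' hP' hQ') g hQX hC hΓ' hΔ'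

/-- A color system: a category `K` of object colors, an ordered polycategory `M` of morphism
colors whose objects are the object colors, and a functorial, identity-on-objects assignment `ι`
of unary morphism colors to the morphisms of `K`. -/
structure ColorSystem (K : Type u) [Category.{v} K] where
  /-- The polycategory of morphism colors. -/
  M : OrderedPolycategory.{u, w} K
  /-- The morphism color of an object-color morphism. -/
  ι : ∀ {c d : K}, (c ⟶ d) → M.Hom [c] [d]
  ι_id : ∀ c : K, ι (𝟙 c) = M.id c
  ι_comp : ∀ {c d e : K} (f : c ⟶ d) (g : d ⟶ e),
    ι (f ≫ g) = M.comp [] [] [] [] d (ι f) (ι g) rfl rfl rfl rfl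

/-! ## Markov polycategories and colored Markov polycategories -/

/-- A Markov polycategory: objects with underlying standard Borel spaces, and for any two profiles
a set of Markov kernels, containing the identity kernels and closed under kernel slotwise
composition. -/
structure MarkovPolycategory where
  /-- Objects. -/
  Ob : Type u
  /-- Underlying space of an object. -/
  carrier : Ob → Type v
  [measurableSpace : ∀ X, MeasurableSpace (carrier X)]
  [standardBorel : ∀ X, StandardBorelSpace (carrier X)]
  /-- Morphisms with given input and output profiles. -/
  Hom : ∀ A B : List Ob, Set (Kernel (Val carrier A) (Val carrier B))
  isMarkov : ∀ {A B : List Ob} {k : Kernel (Val carrier A) (Val carrier B)},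
    k ∈ Hom A B → IsMarkovKernel k
  id_mem : ∀ X : Ob, Kernel.id ∈ Hom [X] [X]
  ksc_mem : ∀ {A B₁ B₂ C₁ C₂ D : List Ob} {X : Ob}
    {k : Kernel (Val carrier A) (Val carrier (B₁ ++ X :: B₂))}
    {l : Kernel (Val carrier (C₁ ++ X :: C₂)) (Val carrier D)},
    k ∈ Hom A (B₁ ++ X :: B₂) → l ∈ Hom (C₁ ++ X :: C₂) D →
    ksc k l ∈ Hom (C₁ ++ A ++ C₂) (B₁ ++ D ++ B₂)

attribute [instance] MarkovPolycategory.measurableSpace MarkovPolycategory.standardBorel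

/-- A colored Markov polycategory over a color system: a Markov polycategory with object colors
`χ`, morphism colors `ψ` compatible with identities and slotwise composition, and an interface
system: sets `Int B C` of admissible witnesses with interface kernels `κ`, coherent with
identities and composition of witnesses. -/
structure CMP {K : Type u} [Category.{v} K] (𝒮 : ColorSystem.{u, v, w} K) extends
    MarkovPolycategory.{x, y} where
  /-- Object colors. -/
  χ : Ob → K
  /-- Morphism colors. -/
  ψ : ∀ {A B : List Ob}, Hom A B → 𝒮.M.Hom (A.map χ) (B.map χ)
  ψ_id : ∀ X : Ob, ψ ⟨_, id_mem X⟩ = 𝒮.M.id (χ X)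
  ψ_ksc : ∀ {A B₁ B₂ C₁ C₂ D : List Ob} {X : Ob}
    (k : Hom A (B₁ ++ X :: B₂)) (l : Hom (C₁ ++ X :: C₂) D),
    ψ ⟨_, ksc_mem k.2 l.2⟩ =
      𝒮.M.comp (B₁.map χ) (B₂.map χ) (C₁.map χ) (C₂.map χ) (χ X) (ψ k) (ψ l)
        (by simp) (by simp) (by simp) (by simp)
  /-- Admissible interface witnesses. -/
  Int : ∀ B C : Ob, Set (χ B ⟶ χ C)
  /-- Interface kernels. -/
  κ : ∀ {B C : Ob}, Int B C → Hom [B] [C]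
  ψ_κ : ∀ {B C : Ob} (f : Int B C), ψ (κ f) = 𝒮.ι f.1
  int_id : ∀ B : Ob, 𝟙 (χ B) ∈ Int B B
  int_comp : ∀ {B C E : Ob} {f : χ B ⟶ χ C} {g : χ C ⟶ χ E},
    f ∈ Int B C → g ∈ Int C E → f ≫ g ∈ Int B E
  κ_id : ∀ B : Ob, (κ ⟨_, int_id B⟩).1 = Kernel.id
  κ_comp : ∀ {B C E : Ob} (f : Int B C) (g : Int C E),
    (κ ⟨_, int_comp f.2 g.2⟩).1 = (κ g).1 ∘ₖ (κ f).1

/-! ## Finite acyclic diagrams -/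

/-- The wiring of a finite acyclic diagram. An input slot is a pair `⟨u, q⟩` of a vertex and a
position in its input profile, and likewise for output slots. Wires are linear, and the external
slots are listed in a chosen order, each exactly once. -/
structure Wiring (Ob : Type u) where
  /-- Vertices. -/
  V : Type z
  [finV : Finite V]
  /-- Input profile of a vertex. -/
  inp : V → List Ob
  /-- Output profile of a vertex. -/
  out : V → List Ob
  /-- Internal wires. -/
  W : Type z
  [finW : Finite W]
  /-- The output slot where a wire starts. -/
  src : W → Σ u : V, Fin (out u).length
  /-- The input slot where a wire ends. -/
  tgt : W → Σ u : V, Fin (inp u).length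
  src_injective : Function.Injective src
  tgt_injective : Function.Injective tgt
  acyclic : ∀ u, ¬ Relation.TransGen (fun a b => ∃ e, (src e).1 = a ∧ (tgt e).1 = b) u u
  /-- Number of external input slots. -/
  numIn : ℕ
  /-- The ordered list of external input slots. -/
  extIn : Fin numIn → Σ u : V, Fin (inp u).length
  extIn_injective : Function.Injective extIn
  extIn_range : ∀ s, (∃ i, extIn i = s) ↔ ∀ e, tgt e ≠ s
  /-- Number of external output slots. -/
  numOut : ℕ
  /-- The ordered list of external output slots. -/
  extOut : Fin numOut → Σ u : V, Fin (out u).length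
  extOut_injective : Function.Injective extOut
  extOut_range : ∀ s, (∃ i, extOut i = s) ↔ ∀ e, src e ≠ s

namespace Wiring

attribute [instance] Wiring.finV Wiring.finW

variable {Ob : Type u} (G : Wiring.{u, z} Ob)

/-- The object at an input slot. -/
def inObj (s : Σ u : G.V, Fin (G.inp u).length) : Ob := (G.inp s.1).get s.2

/-- The object at an output slot. -/
def outObj (s : Σ u : G.V, Fin (G.out u).length) : Ob := (G.out s.1).get s.2

/-- The external input profile. -/
def inProfile : List Ob := List.ofFn fun i => G.inObj (G.extIn i)

/-- The external output profile. -/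
def outProfile : List Ob := List.ofFn fun i => G.outObj (G.extOut i)

/-- A topological ordering of the vertices. -/
structure TopOrder where
  /-- The position of a vertex. -/
  pos : G.V ≃ Fin (Nat.card G.V)
  pos_lt : ∀ e, pos (G.src e).1 < pos (G.tgt e).1

end Wiring

/-- A finite acyclic diagram in a Markov polycategory (an uncolored diagram): vertices are labelled
by morphisms, and wires connect slots with equal objects. -/
structure KSCDiagram (P : MarkovPolycategory.{x, y}) extends Wiring.{x, z} P.Ob where
  /-- The morphism at a vertex. -/
  label : ∀ u, P.Hom (inp u) (out u)
  wire_eq : ∀ e, toWiring.outObj (src e) = toWiring.inObj (tgt e)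

/-- A finite acyclic colored diagram in a colored Markov polycategory: vertices are labelled by
morphisms, and each wire carries an admissible interface witness. -/
structure CKSCDiagram {K : Type u} [Category.{v} K] {𝒮 : ColorSystem.{u, v, w} K}
    (P : CMP.{u, v, w, x, y} 𝒮) extends Wiring.{x, z} P.Ob where
  /-- The morphism at a vertex. -/
  label : ∀ u, P.Hom (inp u) (out u)
  /-- The interface witness of a wire. -/
  witness : ∀ e, P.Int (toWiring.outObj (src e)) (toWiring.inObj (tgt e))

/-! ## Trace kernels of uncolored diagrams -/

namespace KSCDiagram

variable {P : MarkovPolycategory.{x, y}} (G : KSCDiagram.{x, y, z} P)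

variable {G} in
/-- Joint outputs of the vertices in the first `r` positions of a topological ordering. -/
abbrev PartialTrace (σ : G.TopOrder) (r : ℕ) : Type (max z y) :=
  ∀ u : {u : G.V // (σ.pos u).1 < r}, Val P.carrier (G.out u.1)

variable {G}

open Classical in
/-- The value at an input slot of the vertex in position `r`, given the external inputs `a` and the
outputs `t` of the previous vertices: it is read off from the wire that ends at this slot if there
is one, and from the external inputs otherwise. -/
noncomputable def slotValue (σ : G.TopOrder) {r : ℕ} (s : Σ u : G.V, Fin (G.inp u).length)
    (hs : (σ.pos s.1).1 = r) (a : Val P.carrier G.inProfile) (t : PartialTrace σ r) :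
    P.carrier (G.inObj s) :=
  if h : ∃ e, G.tgt e = s then
    castObj (S := P.carrier) ((G.wire_eq h.choose).trans (congrArg G.inObj h.choose_spec))
      (t ⟨(G.src h.choose).1, by
        have h₁ := Fin.lt_def.mp (σ.pos_lt h.choose)
        rw [h.choose_spec, hs] at h₁
        exact h₁⟩ (G.src h.choose).2)
  else
    have h' : ∃ i, G.extIn i = s := (G.extIn_range s).2 (not_exists.mp h)
    castObj (S := P.carrier)
      (by simp only [Wiring.inProfile, List.get_ofFn]; exact congrArg G.inObj h'.choose_spec)
      (a (Fin.cast (by simp [Wiring.inProfile]) h'.choose))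

lemma measurable_slotValue (σ : G.TopOrder) {r : ℕ} (s : Σ u : G.V, Fin (G.inp u).length)
    (hs : (σ.pos s.1).1 = r) :
    Measurable (fun p : Val P.carrier G.inProfile × PartialTrace σ r =>
      slotValue σ s hs p.1 p.2) := by
  by_cases h : ∃ e, G.tgt e = s
  · simp only [slotValue, h, dite_true]
    exact (measurable_castObj _).comp ((measurable_pi_apply _).comp
      ((measurable_pi_apply _).comp measurable_snd))
  · simp only [slotValue, h, dite_false]
    exact (measurable_castObj _).comp ((measurable_pi_apply _).comp measurable_fst)

/-- The input tuple of the vertex `u` in position `r`. -/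
noncomputable def vertexInput (σ : G.TopOrder) {r : ℕ} (u : G.V) (hu : (σ.pos u).1 = r)
    (p : Val P.carrier G.inProfile × PartialTrace σ r) : Val P.carrier (G.inp u) :=
  fun q => slotValue σ ⟨u, q⟩ hu p.1 p.2

lemma measurable_vertexInput (σ : G.TopOrder) {r : ℕ} (u : G.V) (hu : (σ.pos u).1 = r) :
    Measurable (vertexInput σ u hu) :=
  measurable_pi_lambda _ fun q => measurable_slotValue σ ⟨u, q⟩ hu

/-- Extension of a partial trace by the output of the vertex in position `r`. -/
def extendTrace (σ : G.TopOrder) {r : ℕ} (u : G.V) (hu : (σ.pos u).1 = r)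
    (p : PartialTrace σ r × Val P.carrier (G.out u)) : PartialTrace σ (r + 1) :=
  fun z => if h : (σ.pos z.1).1 < r then p.1 ⟨z.1, h⟩ else
    cast (by
      have h₁ : z.1 = u := σ.pos.injective (Fin.ext (by have := z.2; omega))
      rw [h₁]) p.2

lemma measurable_extendTrace (σ : G.TopOrder) {r : ℕ} (u : G.V) (hu : (σ.pos u).1 = r) :
    Measurable (extendTrace σ u hu) := by
  refine measurable_pi_lambda _ fun z => ?_
  by_cases h : (σ.pos z.1).1 < r
  · simp only [extendTrace, h, dite_true]
    exact (measurable_pi_apply _).comp measurable_fst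
  · simp only [extendTrace, h, dite_false]
    obtain ⟨z, hz⟩ := z
    have h₁ : z = u := σ.pos.injective (Fin.ext (by simp only at h; omega))
    subst h₁
    exact measurable_snd

/-- The law of the outputs of the first `r` vertices given the external inputs: the vertex kernels
are applied one after the other in the given topological ordering. -/
noncomputable def partialTraceKernel (σ : G.TopOrder) : ∀ r : ℕ, r ≤ Nat.card G.V →
    Kernel (Val P.carrier G.inProfile) (PartialTrace σ r)
  | 0, _ => Kernel.deterministic (fun _ u => absurd u.2 (Nat.not_lt_zero _)) measurable_const
  | r + 1, h =>
    ((partialTraceKernel σ r (Nat.le_of_succ_le h)) ⊗ₖ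
      ((G.label (σ.pos.symm ⟨r, h⟩)).1.comap
        (vertexInput σ (σ.pos.symm ⟨r, h⟩) (by simp)) (measurable_vertexInput σ _ _))).map
      (extendTrace σ (σ.pos.symm ⟨r, h⟩) (by simp))

/-- The trace measure, conditional on the external inputs: the joint law of the outputs of all
vertices. -/
noncomputable def traceMeasure (σ : G.TopOrder) :
    Kernel (Val P.carrier G.inProfile) (∀ u : G.V, Val P.carrier (G.out u)) :=
  (partialTraceKernel σ (Nat.card G.V) le_rfl).map fun t u => t ⟨u, (σ.pos u).2⟩

variable (G) in
/-- Projection of the outputs of all vertices to the external outputs. -/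
def outputProj (t : ∀ u : G.V, Val P.carrier (G.out u)) : Val P.carrier G.outProfile :=
  fun i => castObj (S := P.carrier)
    (by simp only [Wiring.outProfile]; exact (List.get_ofFn _ i).symm)
    (t (G.extOut (Fin.cast List.length_ofFn i)).1 (G.extOut (Fin.cast List.length_ofFn i)).2)

lemma measurable_outputProj : Measurable (outputProj G) :=
  measurable_pi_lambda _ fun _ => (measurable_castObj _).comp
    ((measurable_pi_apply _).comp (measurable_pi_apply _))

/-- The trace kernel, evaluated along a topological ordering: all internal wires are integrated
out of the trace measure. -/
noncomputable def traceKernel (σ : G.TopOrder) :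
    Kernel (Val P.carrier G.inProfile) (Val P.carrier G.outProfile) :=
  (traceMeasure σ).map (outputProj G)

end KSCDiagram

/-! ## Interface expansion -/

namespace CKSCDiagram

variable {K : Type u} [Category.{v} K] {𝒮 : ColorSystem.{u, v, w} K}
  {P : CMP.{u, v, w, x, y} 𝒮} (D : CKSCDiagram.{u, v, w, x, y, z} P)

/-- Input profiles of the expansion: the vertices `Sum.inr e` are the interface vertices. -/
def expInp : D.V ⊕ D.W → List P.Ob
  | Sum.inl u => D.inp u
  | Sum.inr e => [D.outObj (D.src e)]

/-- Output profiles of the expansion. -/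
def expOut : D.V ⊕ D.W → List P.Ob
  | Sum.inl u => D.out u
  | Sum.inr e => [D.inObj (D.tgt e)]

/-- An input slot of the diagram as an input slot of the expansion. -/
def inlIn (s : Σ u : D.V, Fin (D.inp u).length) : Σ u, Fin (D.expInp u).length :=
  ⟨Sum.inl s.1, s.2⟩

/-- An output slot of the diagram as an output slot of the expansion. -/
def inlOut (s : Σ u : D.V, Fin (D.out u).length) : Σ u, Fin (D.expOut u).length :=
  ⟨Sum.inl s.1, s.2⟩

/-- The input slot of an interface vertex. -/
def ifaceIn (e : D.W) : Σ u, Fin (D.expInp u).length := ⟨Sum.inr e, (0 : Fin 1)⟩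

/-- The output slot of an interface vertex. -/
def ifaceOut (e : D.W) : Σ u, Fin (D.expOut u).length := ⟨Sum.inr e, (0 : Fin 1)⟩

/-- A wire `e` of the diagram gives two wires of the expansion: `Sum.inl e` from the source of `e`
to the interface vertex of `e`, and `Sum.inr e` from there to the target of `e`. -/
def expSrc : D.W ⊕ D.W → Σ u, Fin (D.expOut u).length
  | Sum.inl e => D.inlOut (D.src e)
  | Sum.inr e => D.ifaceOut e

/-- Ends of the wires of the expansion. -/
def expTgt : D.W ⊕ D.W → Σ u, Fin (D.expInp u).length
  | Sum.inl e => D.ifaceIn e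
  | Sum.inr e => D.inlIn (D.tgt e)

lemma inlIn_injective : Function.Injective D.inlIn := by
  rintro ⟨u, p⟩ ⟨u', p'⟩ h
  cases h
  rfl

lemma inlOut_injective : Function.Injective D.inlOut := by
  rintro ⟨u, p⟩ ⟨u', p'⟩ h
  cases h
  rfl

lemma ifaceIn_injective : Function.Injective D.ifaceIn := fun _ _ h =>
  Sum.inr_injective (congrArg Sigma.fst h)

lemma ifaceOut_injective : Function.Injective D.ifaceOut := fun _ _ h =>
  Sum.inr_injective (congrArg Sigma.fst h)

lemma inlIn_ne_ifaceIn (s e) : D.inlIn s ≠ D.ifaceIn e := fun h =>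
  Sum.inl_ne_inr (congrArg Sigma.fst h)

lemma inlOut_ne_ifaceOut (s e) : D.inlOut s ≠ D.ifaceOut e := fun h =>
  Sum.inl_ne_inr (congrArg Sigma.fst h)

lemma expSrc_injective : Function.Injective D.expSrc := by
  rintro (e | e) (e' | e') h
  · exact congrArg _ (D.src_injective (D.inlOut_injective h))
  · exact absurd h (D.inlOut_ne_ifaceOut _ _)
  · exact absurd h.symm (D.inlOut_ne_ifaceOut _ _)
  · exact congrArg _ (D.ifaceOut_injective h)

lemma expTgt_injective : Function.Injective D.expTgt := by
  rintro (e | e) (e' | e') h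
  · exact congrArg _ (D.ifaceIn_injective h)
  · exact absurd h.symm (D.inlIn_ne_ifaceIn _ _)
  · exact absurd h (D.inlIn_ne_ifaceIn _ _)
  · exact congrArg _ (D.tgt_injective (D.inlIn_injective h))

lemma exp_acyclic (a : D.V ⊕ D.W) : ¬ Relation.TransGen
    (fun a b => ∃ e, (D.expSrc e).1 = a ∧ (D.expTgt e).1 = b) a a := by
  have key : ∀ a b, Relation.TransGen
      (fun a b => ∃ e, (D.expSrc e).1 = a ∧ (D.expTgt e).1 = b) a b →
      Relation.ReflTransGen (fun a b => ∃ e, (D.src e).1 = a ∧ (D.tgt e).1 = b)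
        (Sum.elim id (fun e => (D.tgt e).1) a) (Sum.elim id (fun e => (D.src e).1) b) := by
    intro a b h
    induction h with
    | single h =>
      obtain ⟨e | e, rfl, rfl⟩ := h
      · exact Relation.ReflTransGen.refl
      · exact Relation.ReflTransGen.refl
    | tail _ h ih =>
      obtain ⟨e | e, rfl, rfl⟩ := h
      · exact ih
      · exact ih.tail ⟨e, rfl, rfl⟩
  have hW : ∀ e : D.W, ¬ Relation.TransGen
      (fun a b => ∃ e, (D.expSrc e).1 = a ∧ (D.expTgt e).1 = b)
      (Sum.inr e : D.V ⊕ D.W) (Sum.inr e) := fun e h =>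
    D.acyclic _ (Relation.TransGen.head' ⟨e, rfl, rfl⟩ (key _ _ h))
  intro h
  obtain ⟨b, ⟨e | e, rfl, rfl⟩, h'⟩ := Relation.TransGen.head'_iff.mp h
  · exact hW e (Relation.TransGen.tail' h' ⟨Sum.inl e, rfl, rfl⟩)
  · exact hW e h

lemma exp_extIn_range (s) :
    (∃ i, D.inlIn (D.extIn i) = s) ↔ ∀ e, D.expTgt e ≠ s := by
  constructor
  · rintro ⟨i, rfl⟩ (e | e) h
    · exact D.inlIn_ne_ifaceIn _ _ h.symm
    · exact (D.extIn_range _).1 ⟨i, rfl⟩ e (D.inlIn_injective h)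
  · obtain ⟨u | e, p⟩ := s
    · intro h
      obtain ⟨i, hi⟩ := (D.extIn_range ⟨u, p⟩).2 fun e he =>
        h (Sum.inr e) (congrArg D.inlIn he)
      exact ⟨i, congrArg D.inlIn hi⟩
    · intro h
      refine absurd ?_ (h (Sum.inl e))
      exact congrArg (Sigma.mk (Sum.inr e)) (Subsingleton.elim (α := Fin 1) _ _)

lemma exp_extOut_range (s) :
    (∃ i, D.inlOut (D.extOut i) = s) ↔ ∀ e, D.expSrc e ≠ s := by
  constructor
  · rintro ⟨i, rfl⟩ (e | e) h
    · exact (D.extOut_range _).1 ⟨i, rfl⟩ e (D.inlOut_injective h)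
    · exact D.inlOut_ne_ifaceOut _ _ h.symm
  · obtain ⟨u | e, p⟩ := s
    · intro h
      obtain ⟨i, hi⟩ := (D.extOut_range ⟨u, p⟩).2 fun e he =>
        h (Sum.inl e) (congrArg D.inlOut he)
      exact ⟨i, congrArg D.inlOut hi⟩
    · intro h
      refine absurd ?_ (h (Sum.inr e))
      exact congrArg (Sigma.mk (Sum.inr e)) (Subsingleton.elim (α := Fin 1) _ _)

/-- The interface expansion: on every wire `e` a unary vertex labelled by the interface kernel of
the witness of `e` is inserted, and the external slots and their order are kept. -/
def expansion : KSCDiagram.{x, y, z} P.toMarkovPolycategory where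
  V := D.V ⊕ D.W
  inp := D.expInp
  out := D.expOut
  W := D.W ⊕ D.W
  src := D.expSrc
  tgt := D.expTgt
  src_injective := D.expSrc_injective
  tgt_injective := D.expTgt_injective
  acyclic := D.exp_acyclic
  numIn := D.numIn
  extIn i := D.inlIn (D.extIn i)
  extIn_injective := D.inlIn_injective.comp D.extIn_injective
  extIn_range := D.exp_extIn_range
  numOut := D.numOut
  extOut i := D.inlOut (D.extOut i)
  extOut_injective := D.inlOut_injective.comp D.extOut_injective
  extOut_range := D.exp_extOut_range
  label
    | Sum.inl u => D.label u
    | Sum.inr e => P.κ (D.witness e)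
  wire_eq
    | Sum.inl _ => rfl
    | Sum.inr _ => rfl

/-- The trace kernel of a colored diagram: the trace kernel of its interface expansion, evaluated
along a topological ordering of the expansion. The external profiles of the expansion are those of
the diagram. -/
noncomputable def traceKernel (σ : D.expansion.TopOrder) :
    Kernel (Val P.carrier D.inProfile) (Val P.carrier D.outProfile) :=
  KSCDiagram.traceKernel (G := D.expansion) σ

end CKSCDiagram

end MarkovPoly

/-! Interface expansion reduces everything to uncolored diagrams. For fixed external inputs, each
vertex `u` gives an operator `resample` on measurable functions of all vertex outputs: redraw the
output at `u` from its kernel and average. Integrating `f` against the trace measure along an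
ordering `u₁, …, u_N` amounts to evaluating `T_{u₁} (⋯ (T_{u_N} f))` at an arbitrary base point
(`lintegral_partialTraceKernel`). The operators themselves do not involve the ordering.

If no wire joins `u` and `v` directly, neither kernel reads the output of the other, so by Tonelli
the two operators commute (`resample_comm`). Any two topological orderings differ only by exchanges
of vertices without a direct wire between them, so the composites agree
(`foldr_eq_of_perm_of_pairwise`), and hence so do the trace measures and their projections. An
ordering exists because a finite acyclic relation extends to a linear order
(`Wiring.nonempty_topOrder`). -/

namespace MarkovPoly

/-! ## Lists compatible with a relation -/

section Sorting

variable {ι : Type*} {β : Type*}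

/-- Moving an operator to the front of a composite of operators with all of which it commutes on
an invariant class of arguments. -/
lemma foldr_append_cons_of_commute (T : ι → β → β) (p : β → Prop) (hT : ∀ i b, p b → p (T i b))
    (u : ι) (l₁ l₂ : List ι) (hu : ∀ v ∈ l₁, ∀ b, p b → T v (T u b) = T u (T v b)) {b : β}
    (hb : p b) :
    (l₁ ++ u :: l₂).foldr T b = (u :: (l₁ ++ l₂)).foldr T b := by
  have hp : ∀ l : List ι, p (l.foldr T b) := by
    intro l
    induction l with
    | nil => exact hb
    | cons i l ih => exact hT i _ ih
  induction l₁ with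
  | nil => rfl
  | cons v l ih =>
    have h := ih fun w hw => hu w (List.mem_cons_of_mem _ hw)
    simp only [List.cons_append, List.foldr_cons] at h ⊢
    rw [h, hu v List.mem_cons_self _ (hp _)]

/-- If operators indexed by `r`-incomparable indices commute, then the composites along two
orderings compatible with `r` of the same indices agree. -/
lemma foldr_eq_of_perm_of_pairwise (r : ι → ι → Prop) (T : ι → β → β) (p : β → Prop)
    (hT : ∀ i b, p b → p (T i b))
    (hcomm : ∀ i j, i ≠ j → ¬ r i j → ¬ r j i → ∀ b, p b → T i (T j b) = T j (T i b))
    {b : β} (hb : p b) {l₁ l₂ : List ι} (h : l₁.Perm l₂) (hn : l₁.Nodup)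
    (h₁ : l₁.Pairwise fun i j => ¬ r j i) (h₂ : l₂.Pairwise fun i j => ¬ r j i) :
    l₁.foldr T b = l₂.foldr T b := by
  induction l₁ generalizing l₂ with
  | nil => rw [h.nil_eq]
  | cons u l ih =>
    -- The head `u` of the first list occurs somewhere in the second; it is moved to the front
    -- there, and the tails are compared by induction.
    obtain ⟨m₁, m₂, rfl⟩ := List.append_of_mem (h.subset List.mem_cons_self)
    have hperm : l.Perm (m₁ ++ m₂) := (h.trans List.perm_middle).cons_inv
    rw [List.nodup_cons] at hn
    rw [List.pairwise_cons] at h₁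
    rw [List.pairwise_append, List.pairwise_cons] at h₂
    obtain ⟨hm₁, ⟨-, hm₂⟩, hm⟩ := h₂
    rw [foldr_append_cons_of_commute T p hT u m₁ m₂ _ hb, List.foldr_cons, List.foldr_cons,
      ih hperm hn.2 h₁.2 (List.pairwise_append.2
        ⟨hm₁, hm₂, fun i hi j hj => hm i hi j (List.mem_cons_of_mem _ hj)⟩)]
    -- An entry `v` of `m₁` precedes `u` in the second list but follows it in the first, so
    -- compatibility of both lists excludes `r u v` and `r v u`. Transitivity of `r` is not needed.
    intro v hv
    have hvl : v ∈ l := hperm.mem_iff.2 (List.mem_append_left _ hv)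
    exact hcomm v u (fun e => hn.1 (e ▸ hvl)) (h₁.1 v hvl) (hm v hv u List.mem_cons_self)

end Sorting

/-! ## Resampling one coordinate -/

section Resample

variable {ι : Type*} [DecidableEq ι] {Y : ι → Type*} [∀ i, MeasurableSpace (Y i)]

/-- The expectation of `f` after the coordinate `u` has been redrawn from the kernel `κ u`. -/
noncomputable def resample (κ : ∀ i, Kernel (∀ j, Y j) (Y i)) (u : ι) (f : (∀ j, Y j) → ENNReal)
    (t : ∀ j, Y j) : ENNReal :=
  ∫⁻ y, f (Function.update t u y) ∂(κ u t)

lemma measurable_resample (κ : ∀ i, Kernel (∀ j, Y j) (Y i)) [∀ i, IsSFiniteKernel (κ i)] (u : ι)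
    {f : (∀ j, Y j) → ENNReal} (hf : Measurable f) : Measurable (resample κ u f) :=
  Measurable.lintegral_kernel_prod_right'
    (f := fun p : (∀ j, Y j) × Y u => f (Function.update p.1 u p.2)) (hf.comp measurable_update')

/-- Since neither law depends on the other coordinate, both sides are double integrals against the
same two measures, and Tonelli exchanges them. -/
lemma resample_comm (κ : ∀ i, Kernel (∀ j, Y j) (Y i)) [∀ i, IsSFiniteKernel (κ i)] {u v : ι}
    (huv : u ≠ v) (hu : ∀ t y, κ u (Function.update t v y) = κ u t)
    (hv : ∀ t y, κ v (Function.update t u y) = κ v t)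
    {f : (∀ j, Y j) → ENNReal} (hf : Measurable f) :
    resample κ u (resample κ v f) = resample κ v (resample κ u f) := by
  funext t
  simp only [resample, hu, hv]
  rw [lintegral_lintegral_swap]
  · simp only [Function.update_comm huv]
  · refine (hf.comp ?_).aemeasurable
    exact measurable_update'.comp
      (((measurable_update t).comp measurable_fst).prodMk measurable_snd)

end Resample

/-! ## Existence of topological orderings -/

/-- Acyclicity makes reachability antisymmetric, hence a partial order. A linear extension of it on
a finite set is isomorphic to an initial segment of `ℕ`. -/
lemma Wiring.nonempty_topOrder {Ob : Type u} (G : Wiring.{u, z} Ob) : Nonempty G.TopOrder := by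
  classical
  let r : G.V → G.V → Prop := fun a b => ∃ e, (G.src e).1 = a ∧ (G.tgt e).1 = b
  have hpo : IsPartialOrder G.V (Relation.ReflTransGen r) :=
    { refl := fun _ => Relation.ReflTransGen.refl
      trans := fun _ _ _ => Relation.ReflTransGen.trans
      antisymm := fun a b hab hba => by
        rcases Relation.reflTransGen_iff_eq_or_transGen.1 hab with h | h
        · exact h.symm
        · exact absurd (h.trans_left hba) (G.acyclic a) }
  obtain ⟨s, hs, hrs⟩ := extend_partialOrder (Relation.ReflTransGen r)
  let _ : LinearOrder G.V :=
    { le := s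
      le_refl := hs.refl
      le_trans := hs.trans
      le_antisymm := hs.antisymm
      le_total := hs.total
      toDecidableLE := Classical.decRel _ }
  let _ := Fintype.ofFinite G.V
  let φ : Fin (Nat.card G.V) ≃o G.V :=
    Fintype.orderIsoFinOfCardEq G.V Nat.card_eq_fintype_card.symm
  refine ⟨⟨φ.symm.toEquiv, fun e => φ.symm.strictMono (lt_of_le_of_ne ?_ ?_)⟩⟩
  · exact hrs _ _ (Relation.ReflTransGen.single ⟨e, rfl, rfl⟩)
  -- A wire whose two ends lie at the same vertex would be a cycle of length one.
  · exact fun h => G.acyclic _ (Relation.TransGen.single ⟨e, rfl, h.symm⟩)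

/-! ## Independence of the topological ordering -/

namespace KSCDiagram

variable {P : MarkovPolycategory.{x, y}} (G : KSCDiagram.{x, y, z} P)

/-! ### Markov property of the trace kernels -/

instance isMarkovKernel_label (u : G.V) : IsMarkovKernel (G.label u).1 :=
  P.isMarkov (G.label u).2

instance isMarkovKernel_partialTraceKernel {G : KSCDiagram.{x, y, z} P} (σ : G.TopOrder) (r : ℕ)
    (h : r ≤ Nat.card G.V) : IsMarkovKernel (partialTraceKernel σ r h) := by
  induction r with
  | zero => rw [partialTraceKernel]; infer_instance
  | succ r ih =>
    have := ih (Nat.le_of_succ_le h)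
    rw [partialTraceKernel]
    exact Kernel.IsMarkovKernel.map _ (measurable_extendTrace σ _ _)

variable {G} in
lemma measurable_total (σ : G.TopOrder) :
    Measurable fun (t : PartialTrace σ (Nat.card G.V)) (u : G.V) => t ⟨u, (σ.pos u).2⟩ :=
  measurable_pi_lambda _ fun _ => measurable_pi_apply _

instance isMarkovKernel_traceMeasure {G : KSCDiagram.{x, y, z} P} (σ : G.TopOrder) :
    IsMarkovKernel (traceMeasure σ) :=
  Kernel.IsMarkovKernel.map _ (measurable_total σ)

instance isMarkovKernel_traceKernel {G : KSCDiagram.{x, y, z} P} (σ : G.TopOrder) :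
    IsMarkovKernel (traceKernel σ) :=
  Kernel.IsMarkovKernel.map _ measurable_outputProj

/-! ### Vertex kernels on the space of all outputs -/

open Classical in
/-- The value at an input slot, given the external inputs `a` and the outputs `t` of all
vertices. -/
noncomputable def totalSlotValue (s : Σ u : G.V, Fin (G.inp u).length)
    (a : Val P.carrier G.inProfile) (t : ∀ u : G.V, Val P.carrier (G.out u)) :
    P.carrier (G.inObj s) :=
  if h : ∃ e, G.tgt e = s then
    castObj (S := P.carrier) ((G.wire_eq h.choose).trans (congrArg G.inObj h.choose_spec))
      (t (G.src h.choose).1 (G.src h.choose).2)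
  else
    have h' : ∃ i, G.extIn i = s := (G.extIn_range s).2 (not_exists.mp h)
    castObj (S := P.carrier)
      (by simp only [Wiring.inProfile, List.get_ofFn]; exact congrArg G.inObj h'.choose_spec)
      (a (Fin.cast (by simp [Wiring.inProfile]) h'.choose))

/-- The input tuple of a vertex, given the external inputs and the outputs of all vertices. -/
noncomputable def totalInput (a : Val P.carrier G.inProfile) (u : G.V)
    (t : ∀ u : G.V, Val P.carrier (G.out u)) : Val P.carrier (G.inp u) :=
  fun q => G.totalSlotValue ⟨u, q⟩ a t

lemma measurable_totalInput (a : Val P.carrier G.inProfile) (u : G.V) :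
    Measurable (G.totalInput a u) := by
  refine measurable_pi_lambda _ fun q => ?_
  by_cases h : ∃ e, G.tgt e = ⟨u, q⟩
  · simp only [totalInput, totalSlotValue, h, dite_true]
    exact (measurable_castObj _).comp ((measurable_pi_apply _).comp (measurable_pi_apply _))
  · simp only [totalInput, totalSlotValue, h, dite_false]
    exact measurable_const

/-- A vertex reads only the outputs of its direct predecessors. -/
lemma totalInput_congr (a : Val P.carrier G.inProfile) (u : G.V)
    {t t' : ∀ u : G.V, Val P.carrier (G.out u)}
    (h : ∀ e, (G.tgt e).1 = u → t (G.src e).1 = t' (G.src e).1) :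
    G.totalInput a u t = G.totalInput a u t' := by
  funext q
  simp only [totalInput, totalSlotValue]
  split_ifs with hq
  · rw [h _ (congrArg Sigma.fst hq.choose_spec)]
  · rfl

/-- The law of the output of a vertex, given the external inputs and the outputs of all
vertices. -/
noncomputable def vertexKernel (a : Val P.carrier G.inProfile) (u : G.V) :
    Kernel (∀ u : G.V, Val P.carrier (G.out u)) (Val P.carrier (G.out u)) :=
  (G.label u).1.comap (G.totalInput a u) (G.measurable_totalInput a u)

instance isMarkovKernel_vertexKernel (a : Val P.carrier G.inProfile) (u : G.V) :
    IsMarkovKernel (G.vertexKernel a u) := by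
  rw [vertexKernel]; infer_instance

-- This supplies the independence hypotheses of `resample_comm`.
open Classical in
lemma vertexKernel_update (a : Val P.carrier G.inProfile) {u v : G.V}
    (h : ¬ ∃ e, (G.src e).1 = v ∧ (G.tgt e).1 = u)
    (t : ∀ u : G.V, Val P.carrier (G.out u)) (b : Val P.carrier (G.out v)) :
    G.vertexKernel a u (Function.update t v b) = G.vertexKernel a u t := by
  simp only [vertexKernel, Kernel.comap_apply]
  rw [G.totalInput_congr a u fun e he =>
    Function.update_of_ne (fun h' => h ⟨e, h', he⟩) b t]

variable {G}

/-! ### Completion of partial traces -/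

/-- Completion of a partial trace by given values at the remaining vertices. -/
def completeTrace (σ : G.TopOrder) {r : ℕ} (t₀ : ∀ u : G.V, Val P.carrier (G.out u))
    (t : PartialTrace σ r) : ∀ u : G.V, Val P.carrier (G.out u) :=
  fun u => if h : (σ.pos u).1 < r then t ⟨u, h⟩ else t₀ u

lemma measurable_completeTrace (σ : G.TopOrder) {r : ℕ}
    (t₀ : ∀ u : G.V, Val P.carrier (G.out u)) :
    Measurable (completeTrace σ t₀ : PartialTrace σ r → _) := by
  refine measurable_pi_lambda _ fun u => ?_
  by_cases h : (σ.pos u).1 < r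
  · simp only [completeTrace, h, dite_true]
    exact measurable_pi_apply _
  · simp only [completeTrace, h, dite_false]
    exact measurable_const

/-- All wires into the vertex in position `r` start in positions below `r`, so the filler `t₀` is
never read. -/
lemma totalInput_completeTrace (σ : G.TopOrder) {r : ℕ} (a : Val P.carrier G.inProfile)
    (t₀ : ∀ u : G.V, Val P.carrier (G.out u)) (t : PartialTrace σ r) (u : G.V)
    (hu : (σ.pos u).1 = r) :
    G.totalInput a u (completeTrace σ t₀ t) = vertexInput σ u hu (a, t) := by
  funext q
  simp only [totalInput, totalSlotValue, vertexInput, slotValue]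
  split_ifs with hq
  · have h : (σ.pos (G.src hq.choose).1).1 < r := by
      have h₁ := Fin.lt_def.mp (σ.pos_lt hq.choose)
      rwa [hq.choose_spec, hu] at h₁
    simp only [completeTrace, h, dite_true]
    -- Both sides select the wire by the same `choose`, so they agree definitionally.
    rfl
  · rfl

-- On completed traces, drawing the next output becomes an update of one coordinate, which is the
-- form used in `resample`.
open Classical in
lemma completeTrace_extendTrace (σ : G.TopOrder) {r : ℕ}
    (t₀ : ∀ u : G.V, Val P.carrier (G.out u)) (t : PartialTrace σ r) (u : G.V)
    (hu : (σ.pos u).1 = r) (b : Val P.carrier (G.out u)) :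
    completeTrace σ t₀ (extendTrace σ u hu (t, b)) =
      Function.update (completeTrace σ t₀ t) u b := by
  funext w
  by_cases hw : w = u
  · subst hw
    have h₁ : (σ.pos w).1 < r + 1 := by omega
    have h₂ : ¬ (σ.pos w).1 < r := by omega
    simp only [completeTrace, extendTrace, h₁, h₂, dite_true, dite_false, Function.update_self]
    rfl
  · have hne : (σ.pos w).1 ≠ r := fun h =>
      hw (σ.pos.injective (Fin.ext (h.trans hu.symm)))
    rw [Function.update_of_ne hw]
    by_cases h : (σ.pos w).1 < r
    · have h₁ : (σ.pos w).1 < r + 1 := by omega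
      simp only [completeTrace, extendTrace, h, h₁, dite_true]
    · have h₁ : ¬ (σ.pos w).1 < r + 1 := by omega
      simp only [completeTrace, h, h₁, dite_false]

/-! ### Topological orderings as lists -/

/-- The vertices in the first `r` positions of a topological ordering. -/
noncomputable def vertexList (σ : G.TopOrder) (r : ℕ) (h : r ≤ Nat.card G.V) : List G.V :=
  List.ofFn fun i : Fin r => σ.pos.symm (Fin.castLE h i)

lemma vertexList_succ (σ : G.TopOrder) (r : ℕ) (h : r + 1 ≤ Nat.card G.V) :
    vertexList σ (r + 1) h =
      vertexList σ r (Nat.le_of_succ_le h) ++ [σ.pos.symm ⟨r, h⟩] := by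
  rw [vertexList, List.ofFn_succ', List.concat_eq_append]
  rfl

lemma nodup_vertexList (σ : G.TopOrder) (r : ℕ) (h : r ≤ Nat.card G.V) :
    (vertexList σ r h).Nodup :=
  List.nodup_ofFn.2 (σ.pos.symm.injective.comp (Fin.castLE_injective h))

lemma pairwise_vertexList (σ : G.TopOrder) (r : ℕ) (h : r ≤ Nat.card G.V) :
    (vertexList σ r h).Pairwise fun u v => ¬ ∃ e, (G.src e).1 = v ∧ (G.tgt e).1 = u := by
  refine List.pairwise_ofFn.2 ?_
  rintro i j hij ⟨e, hv, hu⟩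
  have h₁ := σ.pos_lt e
  rw [hv, hu, Equiv.apply_symm_apply, Equiv.apply_symm_apply] at h₁
  exact absurd hij (not_lt.2 (Fin.lt_def.1 h₁).le)

lemma mem_vertexList (σ : G.TopOrder) (u : G.V) :
    u ∈ vertexList σ (Nat.card G.V) le_rfl :=
  List.mem_ofFn.2 ⟨σ.pos u, by simp⟩

/-! ### Trace integrals as iterated resamplings, and comparison of orderings -/

open Classical in
/-- Integrals against the partial trace law are iterated resamplings. -/
lemma lintegral_partialTraceKernel (σ : G.TopOrder) (a : Val P.carrier G.inProfile)
    (t₀ : ∀ u : G.V, Val P.carrier (G.out u)) (r : ℕ) (h : r ≤ Nat.card G.V)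
    {f : (∀ u : G.V, Val P.carrier (G.out u)) → ENNReal} (hf : Measurable f) :
    ∫⁻ t, f (completeTrace σ t₀ t) ∂(partialTraceKernel σ r h a) =
      (vertexList σ r h).foldr (resample (G.vertexKernel a)) f t₀ := by
  induction r generalizing f with
  | zero =>
    have hm : Measurable fun t : PartialTrace σ 0 => f (completeTrace σ t₀ t) :=
      hf.comp (measurable_completeTrace σ t₀)
    rw [partialTraceKernel, Kernel.lintegral_deterministic' _ hm]
    -- No vertex has been drawn yet, so the completion is `t₀` itself.
    rfl
  | succ r ih =>
    have hm : Measurable fun t : PartialTrace σ (r + 1) => f (completeTrace σ t₀ t) :=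
      hf.comp (measurable_completeTrace σ t₀)
    -- The vertex drawn last acts innermost in the fold. Its resampling is absorbed into the
    -- integrand, to which the induction hypothesis applies because `f` is generalized.
    rw [vertexList_succ, List.foldr_append, List.foldr_cons, List.foldr_nil,
      ← ih (Nat.le_of_succ_le h) (measurable_resample _ _ hf), partialTraceKernel,
      Kernel.map_apply _ (measurable_extendTrace σ _ _),
      lintegral_map hm (measurable_extendTrace σ _ _)]
    refine (Kernel.lintegral_compProd _ _ _ (hm.comp (measurable_extendTrace σ _ _))).trans ?_
    refine lintegral_congr fun t => ?_
    simp only [Function.comp_apply, completeTrace_extendTrace, resample, vertexKernel, Kernel.comap_apply]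
    rw [totalInput_completeTrace σ a t₀ t _ (by simp)]

lemma traceMeasure_eq (σ τ : G.TopOrder) : traceMeasure σ = traceMeasure τ := by
  classical
  ext1 a
  -- A base point exists because the space carries a probability measure.
  have hne : Nonempty (∀ u : G.V, Val P.carrier (G.out u)) :=
    nonempty_of_isProbabilityMeasure (traceMeasure σ a)
  obtain ⟨t₀⟩ := hne
  have key : ∀ (ρ : G.TopOrder) {f : (∀ u : G.V, Val P.carrier (G.out u)) → ENNReal},
      Measurable f → ∫⁻ t, f t ∂(traceMeasure ρ a) =
        (vertexList ρ (Nat.card G.V) le_rfl).foldr (resample (G.vertexKernel a)) f t₀ := by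
    intro ρ f hf
    rw [← lintegral_partialTraceKernel ρ a t₀ _ le_rfl hf, traceMeasure,
      Kernel.map_apply _ (measurable_total ρ), lintegral_map hf (measurable_total ρ)]
    refine lintegral_congr fun t => congrArg f (funext fun u => ?_)
    -- With all vertices drawn, the completion never falls back on `t₀`.
    simp only [completeTrace, (ρ.pos u).2, dite_true]
  refine Measure.ext_of_lintegral _ fun f hf => ?_
  rw [key σ hf, key τ hf]
  -- The invariant class is that of measurable functions: resampling preserves it, and Tonelli
  -- requires it.
  refine congrFun (foldr_eq_of_perm_of_pairwise
    (fun u v => ∃ e, (G.src e).1 = u ∧ (G.tgt e).1 = v) _ Measurable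
    (fun u f => measurable_resample _ u) ?_ hf ?_ (nodup_vertexList σ _ _)
    (pairwise_vertexList σ _ _) (pairwise_vertexList τ _ _)) t₀
  · exact fun u v huv h₁ h₂ f hf => resample_comm _ huv (G.vertexKernel_update a h₂)
      (G.vertexKernel_update a h₁) hf
  · exact (List.perm_ext_iff_of_nodup (nodup_vertexList σ _ _) (nodup_vertexList τ _ _)).2
      fun u => iff_of_true (mem_vertexList σ u) (mem_vertexList τ u)

/-- The trace kernel does not depend on the topological ordering. -/
theorem traceKernel_eq (σ τ : G.TopOrder) : traceKernel σ = traceKernel τ := by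
  rw [traceKernel, traceKernel, traceMeasure_eq σ τ]

end KSCDiagram

end MarkovPoly

theorem mainTheorem3 {K : Type u} [Category.{v} K] {𝒮 : MarkovPoly.ColorSystem.{u, v, w} K}
    (P : MarkovPoly.CMP.{u, v, w, x, y} 𝒮) (D : MarkovPoly.CKSCDiagram.{u, v, w, x, y, z} P) :
    Nonempty D.expansion.TopOrder ∧
    (∃! Kd : Kernel (MarkovPoly.Val P.carrier D.inProfile) (MarkovPoly.Val P.carrier D.outProfile),
      IsMarkovKernel Kd ∧ ∀ σ : D.expansion.TopOrder, D.traceKernel σ = Kd) := by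
  have hne : Nonempty D.expansion.TopOrder := D.expansion.toWiring.nonempty_topOrder
  refine ⟨hne, ?_⟩
  -- An actual ordering is needed for uniqueness too: without one, the condition over all `σ` would
  -- be vacuous.
  obtain ⟨σ₀⟩ := hne
  refine ⟨D.traceKernel σ₀, ⟨?_, fun σ => MarkovPoly.KSCDiagram.traceKernel_eq σ σ₀⟩,
    fun Kd h => (h.2 σ₀).symm⟩
  exact MarkovPoly.KSCDiagram.isMarkovKernel_traceKernel (G := D.expansion) σ₀
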